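/- Let $d\ge 3$ be an integer and $c>0$. For $f\colon[0,\infty)\to\mathbb R$ let $$\mathcal S_d[f](s)=\int_0^1 f(ts)\,\varrho_d(t)\,dt\quad(s\ge 0),\qquad \varrho_d(t)=\frac{2\Gamma(d/2)}{\sqrt{\pi}\,\Gamma((d-1)/2)}(1-t^2)^{\frac{d-3}{2}},$$ and let $\omega_{d-1}=2\pi^{d/2}/\Gamma(d/2)$. Put $F(s)=(c^2+s^2)^{-1/2}$ and $f(t)=c^{d-1}(c^2+t^2)^{-d/2}$, where the latter formula defines $f$ on all of $\mathbb R$. Then: 1. $F=\mathcal S_d[f]$ on $[0,\infty)$, where the defining integral converges absolutely for every $s\ge 0$. 2. $f\in L^1(\mathbb R)$, and its Fourier transform $\mathcal F_1[f](r)=\int_{\mathbb R} f(x)e^{-2\pi i x r}\,dx$ satisfies, for every $r\in\mathbb R$, $$\mathcal F_1[f](r)=\omega_{d-1}\,(c|r|)^{\frac{d-1}{2}}\,K_{\frac{d-1}{2}}(2\pi c|r|),$$ where $K_\nu(x)=\int_0^\infty e^{-x\cosh t}\cosh(\nu t)\,dt$ ($x>0$) is the modified Bessel function of the second kind, and for $r=0$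 the right-hand side is read as its limit as $r\to 0$. -/

import Mathlib

open Set Filter Topology MeasureTheory
open scoped FourierTransform

noncomputable section

/-- The density `ϱ_d(t) = c_d (1 - t²)^((d-3)/2)` on `(0,1)`, where
`c_d = 2 Γ(d/2) / (√π Γ((d-1)/2))`. -/
def slicingDensity (d : ℕ) (t : ℝ) : ℝ :=
  2 * Real.Gamma ((d : ℝ) / 2) / (Real.sqrt Real.pi * Real.Gamma (((d : ℝ) - 1) / 2)) *
    (1 - t ^ 2) ^ (((d : ℝ) - 3) / 2)

/-- The slicing operator `S_d[f](s) = ∫₀¹ f(ts) ϱ_d(t) dt`. -/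
def slicing (d : ℕ) (f : ℝ → ℝ) (s : ℝ) : ℝ :=
  ∫ t in (0 : ℝ)..1, f (t * s) * slicingDensity d t

/-- The surface measure `ω_{d-1} = 2 π^(d/2) / Γ(d/2)` of the unit sphere in `ℝ^d`. -/
def sphereArea (d : ℕ) : ℝ :=
  2 * Real.pi ^ ((d : ℝ) / 2) / Real.Gamma ((d : ℝ) / 2)

/-- The modified Bessel function of the second kind, of real order `ν` and argument `x > 0`:
`K_ν(x) = ∫₀^∞ exp(-x cosh t) cosh(ν t) dt` (the integral converges for every `x > 0`). -/
def besselK (ν x : ℝ) : ℝ :=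
  ∫ t in Ioi (0 : ℝ), Real.exp (-x * Real.cosh t) * Real.cosh (ν * t)

/-- The basis function `F(s) = (c² + s²)^(-1/2)` of the inverse multiquadric kernel. -/
def imqBasis (c s : ℝ) : ℝ :=
  (c ^ 2 + s ^ 2) ^ (-(1 / 2) : ℝ)

/-- The function `f(t) = c^(d-1) (c² + t²)^(-d/2)`. -/
def imqSlice (d : ℕ) (c t : ℝ) : ℝ :=
  c ^ ((d : ℝ) - 1) * (c ^ 2 + t ^ 2) ^ (-((d : ℝ) / 2))

/-- The function `ω_{d-1} (c|r|)^((d-1)/2) K_{(d-1)/2}(2πc|r|)`, meant for `r ≠ 0`. -/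
def imqSliceFourier (d : ℕ) (c r : ℝ) : ℝ :=
  sphereArea d * (c * |r|) ^ (((d : ℝ) - 1) / 2) *
    besselK (((d : ℝ) - 1) / 2) (2 * Real.pi * c * |r|)

end

/-
The slicing identity is the substitution `v = t √(c² + s²) / √(c² + t² s²)`, which maps `[0, 1]`
onto itself and turns `∫ (1 - v²)^a dv` into the slicing integral.

The Fourier transform comes from Gaussian subordination: `(c² + ‖v‖²)^(-a)` is, up to a constant,
the integral over `u > 0` of `u^(a-1) exp (-π u (c² + ‖v‖²))`. Transforming the Gaussians under the
integral sign leaves `∫ u^(ν-1) exp (-π (c² u + ‖w‖² / u)) du` with `ν = a - n/2`, which the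
substitution `u = (‖w‖ / c) exp y` identifies as a Bessel function `K_ν`. The value at `0` is the
limit because the Fourier transform of an integrable function is continuous.
-/

section Beta

theorem integral_rpow_mul_one_sub_rpow {α β : ℝ} (hα : 0 < α) (hβ : 0 < β) :
    ∫ x in (0 : ℝ)..1, x ^ (α - 1) * (1 - x) ^ (β - 1) = ProbabilityTheory.beta α β := by
  have h : Complex.betaIntegral α β =
      ((∫ x in (0 : ℝ)..1, x ^ (α - 1) * (1 - x) ^ (β - 1) : ℝ) : ℂ) := by
    rw [Complex.betaIntegral, ← intervalIntegral.integral_ofReal]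
    refine intervalIntegral.integral_congr fun x hx => ?_
    rw [uIcc_of_le zero_le_one] at hx
    push_cast [Complex.ofReal_cpow hx.1, Complex.ofReal_cpow (sub_nonneg.2 hx.2)]
    rfl
  rw [ProbabilityTheory.beta_eq_betaIntegralReal α β hα hβ, h, Complex.ofReal_re]

theorem integral_one_sub_sq_rpow {a : ℝ} (ha : -1 < a) :
    ∫ t in (0 : ℝ)..1, (1 - t ^ 2) ^ a = ProbabilityTheory.beta (1 / 2) (a + 1) / 2 := by
  have hsubst := intervalIntegral.integral_comp_mul_deriv_of_deriv_nonneg (a := 0) (b := 1)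
    (f := fun t : ℝ => t ^ 2) (f' := fun t => 2 * t)
    (g := fun x : ℝ => x ^ ((1 / 2 : ℝ) - 1) * (1 - x) ^ (a + 1 - 1)) (by fun_prop)
    (fun t _ => by simpa using hasDerivAt_pow 2 t)
    (fun t ht => by
      rw [min_eq_left zero_le_one] at ht
      linarith [ht.1])
  have hcongr : ∀ t ∈ uIoc (0 : ℝ) 1,
      ((fun x : ℝ => x ^ ((1 / 2 : ℝ) - 1) * (1 - x) ^ (a + 1 - 1)) ∘ fun t : ℝ => t ^ 2) t *
        (2 * t) = 2 * (1 - t ^ 2) ^ a := by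
    intro t ht
    rw [uIoc_of_le zero_le_one] at ht
    have hpow : (t ^ 2) ^ ((1 / 2 : ℝ) - 1) = t⁻¹ := by
      rw [← Real.rpow_natCast, ← Real.rpow_mul ht.1.le, ← Real.rpow_neg_one]
      norm_num
    have ht0 := ht.1.ne'
    simp only [Function.comp, hpow, add_sub_cancel_right]
    field_simp
  rw [intervalIntegral.integral_congr_ae (ae_of_all _ hcongr), intervalIntegral.integral_const_mul,
    one_pow, zero_pow two_ne_zero,
    integral_rpow_mul_one_sub_rpow (by norm_num) (by linarith)] at hsubst
  linarith

end Beta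

section Slicing

/-- The change of variables `t ↦ t √(c² + s²) / √(c² + t² s²)` of `[0, 1]` behind the slicing
identity. -/
noncomputable def slicingSubst (c s t : ℝ) : ℝ :=
  t * √(c ^ 2 + s ^ 2) / √(c ^ 2 + (t * s) ^ 2)

variable {c : ℝ} (hc : c ≠ 0) (s t : ℝ)
include hc

theorem slicingSubst_one : slicingSubst c s 1 = 1 := by
  have : √(c ^ 2 + s ^ 2) ≠ 0 := by positivity
  simp [slicingSubst, this]

theorem hasDerivAt_slicingSubst :
    HasDerivAt (slicingSubst c s)
      (c ^ 2 * √(c ^ 2 + s ^ 2) / (c ^ 2 + (t * s) ^ 2) ^ (3 / 2 : ℝ)) t := by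
  have hq : 0 < c ^ 2 + (t * s) ^ 2 := by positivity
  have hsqrt := Real.sqrt_pos.2 hq
  have hinner : HasDerivAt (fun t : ℝ => c ^ 2 + (t * s) ^ 2) (2 * (t * s) * s) t := by
    simpa using (((hasDerivAt_id t).mul_const s).pow 2).const_add (c ^ 2)
  refine (((hasDerivAt_id t).mul_const √(c ^ 2 + s ^ 2)).div
    (hinner.sqrt hq.ne') hsqrt.ne').congr_deriv ?_
  have hcube : (c ^ 2 + (t * s) ^ 2) ^ (3 / 2 : ℝ) = √(c ^ 2 + (t * s) ^ 2) ^ 3 := by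
    rw [Real.sqrt_eq_rpow, ← Real.rpow_natCast (_ ^ (1 / 2 : ℝ)), ← Real.rpow_mul hq.le]
    norm_num
  have hsq := Real.sq_sqrt hq.le
  rw [hcube]
  generalize √(c ^ 2 + (t * s) ^ 2) = q at hsqrt hsq ⊢
  simp only [id]
  field_simp
  rw [hsq]
  ring

theorem one_sub_slicingSubst_sq :
    1 - slicingSubst c s t ^ 2 = c ^ 2 * (1 - t ^ 2) / (c ^ 2 + (t * s) ^ 2) := by
  have hq : 0 < c ^ 2 + (t * s) ^ 2 := by positivity
  rw [slicingSubst, div_pow, mul_pow, Real.sq_sqrt hq.le, Real.sq_sqrt (by positivity)]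
  field_simp
  ring

variable {t} in
theorem one_sub_slicingSubst_sq_rpow_mul_deriv (ht : t ∈ Icc (0 : ℝ) 1) (a : ℝ) :
    (1 - slicingSubst c s t ^ 2) ^ a *
        (c ^ 2 * √(c ^ 2 + s ^ 2) / (c ^ 2 + (t * s) ^ 2) ^ (3 / 2 : ℝ)) =
      (c ^ 2) ^ (a + 1) * √(c ^ 2 + s ^ 2) *
        ((c ^ 2 + (t * s) ^ 2) ^ (-(a + 3 / 2)) * (1 - t ^ 2) ^ a) := by
  have hc2 : 0 < c ^ 2 := by positivity
  have hq : 0 < c ^ 2 + (t * s) ^ 2 := by positivity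
  have ht2 : 0 ≤ 1 - t ^ 2 := by nlinarith [ht.1, ht.2]
  rw [one_sub_slicingSubst_sq hc, Real.div_rpow (by positivity) hq.le, Real.mul_rpow hc2.le ht2,
    Real.rpow_neg hq.le, Real.rpow_add hq, Real.rpow_add_one hc2.ne']
  field_simp

theorem integral_sq_add_sq_rpow_mul_one_sub_sq_rpow (a : ℝ) :
    ∫ t in (0 : ℝ)..1, (c ^ 2 + (t * s) ^ 2) ^ (-(a + 3 / 2)) * (1 - t ^ 2) ^ a =
      (c ^ 2) ^ (-(a + 1)) * (c ^ 2 + s ^ 2) ^ (-(1 / 2) : ℝ) *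
        ∫ t in (0 : ℝ)..1, (1 - t ^ 2) ^ a := by
  have hc2 : 0 < c ^ 2 := by positivity
  have hsubst := intervalIntegral.integral_comp_mul_deriv_of_deriv_nonneg (a := 0) (b := 1)
    (g := fun v : ℝ => (1 - v ^ 2) ^ a)
    (fun t _ => (hasDerivAt_slicingSubst hc s t).continuousAt.continuousWithinAt)
    (fun t _ => hasDerivAt_slicingSubst hc s t) (fun t _ => by positivity)
  have hzero : slicingSubst c s 0 = 0 := by simp [slicingSubst]
  simp only [Function.comp_apply] at hsubst
  rw [slicingSubst_one hc, hzero, intervalIntegral.integral_congr fun t ht =>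
    one_sub_slicingSubst_sq_rpow_mul_deriv hc s (uIcc_of_le (zero_le_one' ℝ) ▸ ht) a,
    intervalIntegral.integral_const_mul] at hsubst
  have hpow := Real.rpow_pos_of_pos hc2 (a + 1)
  have hsqrt : 0 < √(c ^ 2 + s ^ 2) := by positivity
  rw [← hsubst, Real.rpow_neg hc2.le, Real.rpow_neg (by positivity), ← Real.sqrt_eq_rpow,
    ← mul_inv, inv_mul_cancel_left₀ (mul_pos hpow hsqrt).ne']

end Slicing

section SlicingDensity

variable {d : ℕ} (hd : 2 ≤ d)
include hd

theorem integral_slicingDensity : ∫ t in (0 : ℝ)..1, slicingDensity d t = 1 := by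
  have hd' : (2 : ℝ) ≤ d := by exact_mod_cast hd
  have := Real.Gamma_pos_of_pos (show 0 < (d : ℝ) / 2 by linarith)
  have := Real.Gamma_pos_of_pos (show 0 < ((d : ℝ) - 1) / 2 by linarith)
  simp only [slicingDensity]
  rw [intervalIntegral.integral_const_mul, integral_one_sub_sq_rpow (by linarith),
    ProbabilityTheory.beta, Real.Gamma_one_half_eq,
    show ((d : ℝ) - 3) / 2 + 1 = (d - 1) / 2 by ring,
    show 1 / 2 + ((d : ℝ) - 1) / 2 = d / 2 by ring]
  field_simp

theorem intervalIntegrable_slicingDensity :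
    IntervalIntegrable (slicingDensity d) volume 0 1 :=
  intervalIntegral.intervalIntegrable_of_integral_ne_zero
    ((integral_slicingDensity hd).trans_ne one_ne_zero)

theorem slicing_imqSlice {c : ℝ} (hc : 0 < c) (s : ℝ) :
    slicing d (imqSlice d c) s = imqBasis c s := by
  have hpow : c ^ ((d : ℝ) - 1) * (c ^ 2) ^ (-(((d : ℝ) - 3) / 2 + 1)) = 1 := by
    rw [← Real.rpow_natCast c 2, ← Real.rpow_mul hc.le, ← Real.rpow_add hc]
    convert Real.rpow_zero c using 2
    push_cast
    ring
  set C := 2 * Real.Gamma ((d : ℝ) / 2) / (√Real.pi * Real.Gamma (((d : ℝ) - 1) / 2)) with hC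
  have hone : C * ∫ t in (0 : ℝ)..1, (1 - t ^ 2) ^ (((d : ℝ) - 3) / 2) = 1 := by
    rw [← intervalIntegral.integral_const_mul]
    exact integral_slicingDensity hd
  calc slicing d (imqSlice d c) s
    _ = ∫ t in (0 : ℝ)..1, c ^ ((d : ℝ) - 1) * C * ((c ^ 2 + (t * s) ^ 2) ^
          (-(((d : ℝ) - 3) / 2 + 3 / 2)) * (1 - t ^ 2) ^ (((d : ℝ) - 3) / 2)) := by
      refine intervalIntegral.integral_congr fun t _ => ?_
      rw [show ((d : ℝ) - 3) / 2 + 3 / 2 = d / 2 by ring]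
      simp only [imqSlice, slicingDensity, ← hC]
      ring
    _ = (c ^ ((d : ℝ) - 1) * (c ^ 2) ^ (-(((d : ℝ) - 3) / 2 + 1))) * imqBasis c s *
          (C * ∫ t in (0 : ℝ)..1, (1 - t ^ 2) ^ (((d : ℝ) - 3) / 2)) := by
      rw [intervalIntegral.integral_const_mul,
        integral_sq_add_sq_rpow_mul_one_sub_sq_rpow hc.ne', imqBasis]
      ring
    _ = imqBasis c s := by rw [hpow, hone, one_mul, mul_one]

end SlicingDensity

section BesselK

theorem one_add_sq_div_two_le_cosh (y : ℝ) : 1 + y ^ 2 / 2 ≤ Real.cosh y := by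
  have h := sum_le_hasSum (Finset.range 2)
    (fun n _ => div_nonneg ((even_two_mul n).pow_nonneg y) (Nat.cast_nonneg _))
    (Real.hasSum_cosh y)
  simpa [Finset.sum_range_succ] using h

theorem integral_Ioi_zero_eq_integral_exp_smul {E : Type*} [NormedAddCommGroup E]
    [NormedSpace ℝ E] (g : ℝ → E) :
    ∫ u in Ioi (0 : ℝ), g u = ∫ y : ℝ, Real.exp y • g (Real.exp y) := by
  rw [← Real.range_exp, ← image_univ, integral_image_eq_integral_abs_deriv_smul MeasurableSet.univ
    (fun y _ => (Real.hasDerivAt_exp y).hasDerivWithinAt) Real.exp_injective.injOn]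
  simp only [Real.abs_exp, Measure.restrict_univ]

variable {x : ℝ} (hx : 0 < x) (ν : ℝ)
include hx

theorem integrable_exp_mul_exp_neg_mul_cosh :
    Integrable fun y : ℝ => Real.exp (ν * y) * Real.exp (-x * Real.cosh y) := by
  have hgauss : Integrable fun y : ℝ => Real.exp (-(x / 2) * y ^ 2 + ν * y + -x) := by
    have h := (integrable_cexp_quadratic (b := (x / 2 : ℝ)) (by simpa using hx) ν (-x : ℝ)).norm
    refine h.congr (ae_of_all _ fun y => ?_)
    simp only [Complex.norm_exp]
    norm_cast
  refine hgauss.mono' (by fun_prop) (ae_of_all _ fun y => ?_)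
  rw [← Real.exp_add, Real.norm_of_nonneg (Real.exp_nonneg _), Real.exp_le_exp]
  nlinarith [one_add_sq_div_two_le_cosh y]

theorem integral_exp_mul_exp_neg_mul_cosh :
    ∫ y : ℝ, Real.exp (ν * y) * Real.exp (-x * Real.cosh y) = 2 * besselK ν x := by
  have hint := integrable_exp_mul_exp_neg_mul_cosh hx ν
  have hsymm : (∫ y : ℝ, Real.exp (ν * y) * Real.exp (-x * Real.cosh y)) +
      ∫ y : ℝ, Real.exp (ν * y) * Real.exp (-x * Real.cosh y) =
      2 * ∫ y : ℝ, Real.exp (-x * Real.cosh |y|) * Real.cosh (ν * |y|) := by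
    nth_rewrite 2 [← integral_neg_eq_self]
    rw [← integral_add hint hint.comp_neg, ← integral_const_mul]
    refine integral_congr_ae (ae_of_all _ fun y => ?_)
    have hcosh : Real.cosh (ν * |y|) = Real.cosh (ν * y) := by
      rw [← Real.cosh_abs, abs_mul, abs_abs, ← abs_mul, Real.cosh_abs]
    simp only [Real.cosh_neg, Real.cosh_abs, hcosh, Real.cosh_eq (ν * y), mul_neg]
    ring
  rw [integral_comp_abs (f := fun y => Real.exp (-x * Real.cosh y) * Real.cosh (ν * y))] at hsymm
  rw [besselK]
  linarith

theorem integral_rpow_mul_exp_neg_add_inv :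
    ∫ u in Ioi (0 : ℝ), u ^ (ν - 1) * Real.exp (-(x / 2 * (u + u⁻¹))) = 2 * besselK ν x := by
  rw [integral_Ioi_zero_eq_integral_exp_smul, ← integral_exp_mul_exp_neg_mul_cosh hx]
  refine integral_congr_ae (ae_of_all _ fun y => ?_)
  have hpow : Real.exp y * Real.exp y ^ (ν - 1) = Real.exp (ν * y) := by
    rw [← Real.exp_mul, ← Real.exp_add]
    ring_nf
  simp only [smul_eq_mul]
  rw [← mul_assoc, hpow, Real.cosh_eq, Real.exp_neg y]
  ring_nf

theorem integral_rpow_mul_exp_neg_div_add_div {l : ℝ} (hl : 0 < l) :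
    ∫ u in Ioi (0 : ℝ), u ^ (ν - 1) * Real.exp (-(x / 2 * (u / l + l / u))) =
      2 * l ^ ν * besselK ν x := by
  have hscale := integral_comp_mul_left_Ioi'
    (fun u : ℝ => u ^ (ν - 1) * Real.exp (-(x / 2 * (u / l + l / u)))) 0 hl
  rw [mul_zero] at hscale
  rw [← hscale, mul_right_comm, ← integral_rpow_mul_exp_neg_add_inv hx, smul_eq_mul,
    ← integral_const_mul, ← integral_mul_const]
  refine setIntegral_congr_fun measurableSet_Ioi fun u (hu : 0 < u) => ?_
  have hpow : l * (l * u) ^ (ν - 1) = u ^ (ν - 1) * l ^ ν := by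
    rw [Real.mul_rpow hl.le hu.le, Real.rpow_sub_one hl.ne']
    field_simp
  rw [← mul_assoc, hpow, mul_div_cancel_left₀ u hl.ne', div_mul_cancel_left₀ hl.ne']
  ring

end BesselK

section Subordination

/-- The integrand `u^(a-1) exp (-π q u)` of the subordination integral for `q^(-a)`, meant for
`u > 0`. The factor `π` matches the normalisation of `𝓕`. -/
noncomputable def subordinand (a q u : ℝ) : ℝ :=
  u ^ (a - 1) * Real.exp (-(Real.pi * q * u))

theorem subordinand_nonneg (a q : ℝ) {u : ℝ} (hu : 0 ≤ u) : 0 ≤ subordinand a q u := by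
  unfold subordinand
  positivity

theorem integral_subordinand {a q : ℝ} (ha : 0 < a) (hq : 0 < q) :
    ∫ u in Ioi (0 : ℝ), subordinand a q u = Real.Gamma a / Real.pi ^ a * q ^ (-a) := by
  simp only [subordinand]
  rw [Real.integral_rpow_mul_exp_neg_mul_Ioi ha (by positivity), one_div,
    Real.inv_rpow (by positivity), Real.mul_rpow Real.pi_pos.le hq.le, Real.rpow_neg hq.le]
  field_simp

theorem integrableOn_subordinand {a q : ℝ} (ha : 0 < a) (hq : 0 < q) :
    IntegrableOn (subordinand a q) (Ioi 0) := by
  have := Real.Gamma_pos_of_pos ha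
  refine Integrable.of_integral_ne_zero ?_
  rw [integral_subordinand ha hq]
  positivity

variable {E : Type*} [NormedAddCommGroup E] [NormedSpace ℝ E] [FiniteDimensional ℝ E]
  [MeasurableSpace E] [BorelSpace E] (μ : Measure E) [μ.IsAddHaarMeasure] {a c : ℝ}
  (ha : Module.finrank ℝ E < 2 * a) (hc : c ≠ 0)
include ha hc

theorem integrable_sq_add_norm_sq_rpow_neg :
    Integrable (fun v : E => (c ^ 2 + ‖v‖ ^ 2) ^ (-a)) μ := by
  have hscaled := (integrable_rpow_neg_one_add_norm_sq (μ := μ) ha).comp_smul (inv_ne_zero hc)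
  refine (hscaled.const_mul ((c ^ 2) ^ (-a))).congr (ae_of_all _ fun v => ?_)
  have hfactor : c ^ 2 + ‖v‖ ^ 2 = c ^ 2 * (1 + ‖c⁻¹ • v‖ ^ 2) := by
    rw [norm_smul, norm_inv, Real.norm_eq_abs, mul_pow, inv_pow, sq_abs]
    field_simp
  simp only
  rw [hfactor, Real.mul_rpow (by positivity) (by positivity), neg_div,
    mul_div_cancel_left₀ a two_ne_zero]

theorem integrable_uncurry_subordinand_sq_add_norm_sq :
    Integrable (Function.uncurry fun v : E => subordinand a (c ^ 2 + ‖v‖ ^ 2))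
      (μ.prod (volume.restrict (Ioi 0))) := by
  have ha0 : 0 < a := by linarith [(Module.finrank ℝ E).cast_nonneg (α := ℝ)]
  have hq (v : E) : 0 < c ^ 2 + ‖v‖ ^ 2 := by positivity
  have hnorm (v : E) : ∫ u in Ioi (0 : ℝ), ‖subordinand a (c ^ 2 + ‖v‖ ^ 2) u‖ =
      Real.Gamma a / Real.pi ^ a * (c ^ 2 + ‖v‖ ^ 2) ^ (-a) := by
    rw [← integral_subordinand ha0 (hq v)]
    exact setIntegral_congr_fun measurableSet_Ioi fun u hu =>
      Real.norm_of_nonneg (subordinand_nonneg a _ (le_of_lt hu))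
  rw [integrable_prod_iff (by unfold Function.uncurry subordinand; fun_prop)]
  refine ⟨ae_of_all _ fun v => integrableOn_subordinand ha0 (hq v), ?_⟩
  simp only [Function.uncurry, hnorm]
  exact (integrable_sq_add_norm_sq_rpow_neg μ ha hc).const_mul _

end Subordination

section Fourier

variable {V : Type*} [NormedAddCommGroup V] [InnerProductSpace ℝ V] [FiniteDimensional ℝ V]
  [MeasurableSpace V] [BorelSpace V]

section General

variable {E : Type*} [NormedAddCommGroup E] [NormedSpace ℂ E]

theorem continuous_fourier_of_integrable {f : V → E} (hf : Integrable f) : Continuous (𝓕 f) :=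
  VectorFourier.fourierIntegral_continuous Real.continuous_fourierChar
    (innerSL ℝ).continuous₂ hf

theorem fourier_const_smul (r : ℂ) (f : V → E) (w : V) : 𝓕 (fun v => r • f v) w = r • 𝓕 f w :=
  congrFun (VectorFourier.fourierIntegral_const_smul _ _ _ f r) w

theorem fourier_integral_eq_integral_fourier {α : Type*} [MeasurableSpace α] {μ : Measure α}
    [SFinite μ] {g : V → α → E} (hg : Integrable (Function.uncurry g) (volume.prod μ)) (w : V) :
    𝓕 (fun v => ∫ u, g v u ∂μ) w = ∫ u, 𝓕 (fun v => g v u) w ∂μ := by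
  have hphase : Measurable fun p : V × α => -inner ℝ p.1 w := by fun_prop
  have hchar := Real.continuous_fourierChar.comp_aestronglyMeasurable
    (hphase.aestronglyMeasurable (μ := volume.prod μ))
  simp_rw [Real.fourier_eq, Circle.smul_def, ← integral_smul, ← Circle.smul_def]
  exact integral_integral_swap (hg.mono (hchar.smul hg.aestronglyMeasurable)
    (ae_of_all _ fun p => by simp [Function.uncurry]))

end General

theorem fourier_subordinand_sq_add_norm_sq (a c : ℝ) {u : ℝ} (hu : 0 < u) (w : V) :
    𝓕 (fun v : V => (subordinand a (c ^ 2 + ‖v‖ ^ 2) u : ℂ)) w =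
      (u ^ (a - Module.finrank ℝ V / 2 - 1) *
        Real.exp (-(Real.pi * (c ^ 2 * u + ‖w‖ ^ 2 / u))) : ℝ) := by
  have hsplit (v : V) : (subordinand a (c ^ 2 + ‖v‖ ^ 2) u : ℂ) =
      ((u ^ (a - 1) * Real.exp (-(Real.pi * c ^ 2 * u)) : ℝ) : ℂ) •
        Complex.exp (-(Real.pi * u : ℝ) * ‖v‖ ^ 2) := by
    rw [subordinand, mul_add, add_mul, neg_add, Real.exp_add]
    push_cast
    rw [smul_eq_mul]
    ring_nf
  have hgauss : 𝓕 (fun v : V => Complex.exp (-(Real.pi * u : ℝ) * ‖v‖ ^ 2)) w =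
      (u ^ (-(Module.finrank ℝ V / 2) : ℝ) * Real.exp (-(Real.pi * ‖w‖ ^ 2 / u)) : ℝ) := by
    have hscale : Real.pi / (Real.pi * u) = u⁻¹ := by field_simp
    have hexponent : -Real.pi ^ 2 * ‖w‖ ^ 2 / (Real.pi * u) = -(Real.pi * ‖w‖ ^ 2 / u) := by
      field_simp
    rw [fourier_gaussian_innerProductSpace (by rw [Complex.ofReal_re]; positivity),
      Real.rpow_neg hu.le, ← Real.inv_rpow hu.le, ← hscale, ← hexponent]
    push_cast [Complex.ofReal_cpow (show 0 ≤ Real.pi / (Real.pi * u) by positivity)]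
    rfl
  simp only [hsplit]
  rw [fourier_const_smul, hgauss, smul_eq_mul, ← Complex.ofReal_mul, mul_mul_mul_comm,
    ← Real.rpow_add hu, ← Real.exp_add]
  ring_nf

theorem fourier_sq_add_norm_sq_rpow_neg {a c : ℝ} (ha : Module.finrank ℝ V < 2 * a) (hc : 0 < c)
    {w : V} (hw : w ≠ 0) :
    𝓕 (fun v : V => (((c ^ 2 + ‖v‖ ^ 2) ^ (-a) : ℝ) : ℂ)) w =
      (2 * Real.pi ^ a / Real.Gamma a * (‖w‖ / c) ^ (a - Module.finrank ℝ V / 2) *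
        besselK (a - Module.finrank ℝ V / 2) (2 * Real.pi * c * ‖w‖) : ℝ) := by
  have ha0 : 0 < a := by linarith [(Module.finrank ℝ V).cast_nonneg (α := ℝ)]
  have := Real.Gamma_pos_of_pos ha0
  have hw0 : 0 < ‖w‖ := norm_pos_iff.2 hw
  have hsubord (v : V) : (((c ^ 2 + ‖v‖ ^ 2) ^ (-a) : ℝ) : ℂ) =
      ((Real.pi ^ a / Real.Gamma a : ℝ) : ℂ) •
        ∫ u in Ioi (0 : ℝ), (subordinand a (c ^ 2 + ‖v‖ ^ 2) u : ℂ) := by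
    rw [integral_complex_ofReal, integral_subordinand ha0 (by positivity), smul_eq_mul,
      ← Complex.ofReal_mul]
    congr 1
    field_simp
  have hbessel : ∫ u in Ioi (0 : ℝ), u ^ (a - Module.finrank ℝ V / 2 - 1) *
        Real.exp (-(Real.pi * (c ^ 2 * u + ‖w‖ ^ 2 / u))) =
      2 * (‖w‖ / c) ^ (a - Module.finrank ℝ V / 2) *
        besselK (a - Module.finrank ℝ V / 2) (2 * Real.pi * c * ‖w‖) := by
    rw [← integral_rpow_mul_exp_neg_div_add_div (by positivity) _ (div_pos hw0 hc)]
    refine setIntegral_congr_fun measurableSet_Ioi fun u (hu : 0 < u) => ?_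
    congr 3
    field_simp
  have hint := (integrable_uncurry_subordinand_sq_add_norm_sq (volume : Measure V) ha
    hc.ne').ofReal (𝕜 := ℂ)
  calc 𝓕 (fun v : V => (((c ^ 2 + ‖v‖ ^ 2) ^ (-a) : ℝ) : ℂ)) w
    _ = ((Real.pi ^ a / Real.Gamma a : ℝ) : ℂ) • 𝓕 (fun v : V =>
          ∫ u in Ioi (0 : ℝ), (subordinand a (c ^ 2 + ‖v‖ ^ 2) u : ℂ)) w := by
      simp only [hsubord]
      exact fourier_const_smul _ _ _
    _ = ((Real.pi ^ a / Real.Gamma a : ℝ) : ℂ) • ∫ u in Ioi (0 : ℝ),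
          𝓕 (fun v : V => (subordinand a (c ^ 2 + ‖v‖ ^ 2) u : ℂ)) w := by
      rw [fourier_integral_eq_integral_fourier hint]
    _ = _ := by
      rw [setIntegral_congr_fun measurableSet_Ioi fun u hu =>
        fourier_subordinand_sq_add_norm_sq a c hu w, integral_complex_ofReal, hbessel,
        smul_eq_mul, ← Complex.ofReal_mul]
      congr 1
      ring

end Fourier

section ImqSlice

variable {d : ℕ} {c : ℝ} (hc : 0 < c)
include hc

theorem continuous_imqSlice (d : ℕ) : Continuous (imqSlice d c) :=
  continuous_const.mul
    (Continuous.rpow_const (by fun_prop) fun t => Or.inl (by positivity))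

variable (hd : 2 ≤ d)
include hd

theorem intervalIntegrable_imqSlice_mul_slicingDensity (s : ℝ) :
    IntervalIntegrable (fun t => imqSlice d c (t * s) * slicingDensity d t) volume 0 1 :=
  (intervalIntegrable_slicingDensity hd).continuousOn_mul
    ((continuous_imqSlice hc d).comp (continuous_mul_const s)).continuousOn

theorem integrable_imqSlice : Integrable (imqSlice d c) := by
  have ha : Module.finrank ℝ ℝ < 2 * ((d : ℝ) / 2) := by
    simpa [mul_div_cancel₀] using Nat.lt_of_succ_le hd
  have h := (integrable_sq_add_norm_sq_rpow_neg volume ha hc.ne').const_mul (c ^ ((d : ℝ) - 1))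
  simp only [Real.norm_eq_abs, sq_abs] at h
  exact h

theorem fourier_imqSlice {r : ℝ} (hr : r ≠ 0) :
    𝓕 (fun t : ℝ => (imqSlice d c t : ℂ)) r = (imqSliceFourier d c r : ℂ) := by
  have ha : Module.finrank ℝ ℝ < 2 * ((d : ℝ) / 2) := by
    simpa [mul_div_cancel₀] using Nat.lt_of_succ_le hd
  have hsplit (t : ℝ) : (imqSlice d c t : ℂ) =
      ((c ^ ((d : ℝ) - 1) : ℝ) : ℂ) • (((c ^ 2 + ‖t‖ ^ 2) ^ (-((d : ℝ) / 2)) : ℝ) : ℂ) := by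
    rw [imqSlice, Real.norm_eq_abs, sq_abs, Complex.ofReal_mul, smul_eq_mul]
  have horder : (d : ℝ) / 2 - Module.finrank ℝ ℝ / 2 = (d - 1) / 2 := by
    rw [Module.finrank_self]
    ring
  have hpow : c ^ ((d : ℝ) - 1) * (|r| / c) ^ (((d : ℝ) - 1) / 2) =
      (c * |r|) ^ (((d : ℝ) - 1) / 2) := by
    rw [Real.div_rpow (abs_nonneg r) hc.le, Real.mul_rpow hc.le (abs_nonneg r),
      ← add_halves ((d : ℝ) - 1), Real.rpow_add hc, add_halves]
    field_simp
  simp only [hsplit]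
  rw [fourier_const_smul, fourier_sq_add_norm_sq_rpow_neg ha hc hr, horder, smul_eq_mul,
    ← Complex.ofReal_mul, imqSliceFourier, sphereArea, ← hpow, Real.norm_eq_abs]
  congr 1
  ring

theorem tendsto_imqSliceFourier :
    Tendsto (fun r : ℝ => (imqSliceFourier d c r : ℂ)) (𝓝[≠] 0)
      (𝓝 (𝓕 (fun t : ℝ => (imqSlice d c t : ℂ)) 0)) := by
  have hcont := continuous_fourier_of_integrable ((integrable_imqSlice hc hd).ofReal (𝕜 := ℂ))
  refine ((hcont.tendsto 0).mono_left nhdsWithin_le_nhds).congr' ?_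
  filter_upwards [self_mem_nhdsWithin] with r hr using fourier_imqSlice hc hd hr

end ImqSlice

theorem proposition3p1_general (d : ℕ) (hd : 2 ≤ d) (c : ℝ) (hc : 0 < c) :
    (∀ s : ℝ,
      IntervalIntegrable (fun t : ℝ => imqSlice d c (t * s) * slicingDensity d t) volume 0 1 ∧
      imqBasis c s = slicing d (imqSlice d c) s) ∧
    Integrable (imqSlice d c) ∧
    (∀ r : ℝ, r ≠ 0 →
      𝓕 (fun t : ℝ => (imqSlice d c t : ℂ)) r = (imqSliceFourier d c r : ℂ)) ∧
    Tendsto (fun r : ℝ => (imqSliceFourier d c r : ℂ)) (𝓝[≠] 0)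
      (𝓝 (𝓕 (fun t : ℝ => (imqSlice d c t : ℂ)) 0)) :=
  ⟨fun s => ⟨intervalIntegrable_imqSlice_mul_slicingDensity hc hd s,
      (slicing_imqSlice hd hc s).symm⟩,
    integrable_imqSlice hc hd, fun _ => fourier_imqSlice hc hd, tendsto_imqSliceFourier hc hd⟩

theorem proposition3p1 (d : ℕ) (hd : 3 ≤ d) (c : ℝ) (hc : 0 < c) :
    (∀ s : ℝ, 0 ≤ s →
      IntervalIntegrable (fun t : ℝ => imqSlice d c (t * s) * slicingDensity d t) volume 0 1 ∧
      imqBasis c s = slicing d (imqSlice d c) s) ∧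
    Integrable (imqSlice d c) ∧
    (∀ r : ℝ, r ≠ 0 →
      𝓕 (fun t : ℝ => (imqSlice d c t : ℂ)) r = (imqSliceFourier d c r : ℂ)) ∧
    Tendsto (fun r : ℝ => (imqSliceFourier d c r : ℂ)) (𝓝[≠] 0)
      (𝓝 (𝓕 (fun t : ℝ => (imqSlice d c t : ℂ)) 0)) := by
  have h := proposition3p1_general d (by omega) c hc
  exact ⟨fun s _ => h.1 s, h.2⟩
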